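/- **Simple stochastic games.** A simple stochastic game (SSG) $G=(S,A,T,R,S_{\max},S_{\min})$ consists of a finite set $S$ of states; for each $s\in S$ a finite (possibly empty) set $A(s)\subseteq A$ of enabled actions; transition probabilities $T_a(s,s')\in[0,1]$ with $T_a(s):=\sum_{s'\in S}T_a(s,s')\le 1$ for all $s\in S$, $a\in A$; rewards $R_a(s)\in[0,\infty)$; and a partition $S=S_{\max}\sqcup S_{\min}$. Its Bellman operator $f_G\colon[0,\infty)^S\to[0,\infty)^S$ is $$f_G(v)(s)=\max_{a\in A(s)}\Bigl(R_a(s)+\sum_{s'}T_a(s,s')v(s')\Bigr)\ \text{ for } s\in S_{\max},$$ with $\min$ in place of $\max$ for $s\in S_{\min}$, and $f_G(v)(s)=0$ if $A(s)=\emptyset$. A *sampling* of $G$ is a sequence of SSGs $G_n=(S,A,T_n,R_n,S_{\max},S_{\min})$, $n\ge 0$, with the same states, enabled actions and partition, such that $T_n\to T$ and $R_n\to R$ pointwise and, for all $s,s'\in S$, $a\in A$ and $n\ge1$: $T_a(s,s')=0$ implies $(T_n)_a(s,s')=0$; $R_a(s)=0$ implies $(R_n)_a(s)=0$; and $T_a(s)=1$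 implies $(T_n)_a(s)=1$. **Least fixpoints.** For $f\colon[0,\infty)^S\to[0,\infty)^S$, $\mu f\in[0,\infty]^S$ denotes the least fixpoint of the extension $\bar f\colon[0,\infty]^S\to[0,\infty]^S$, $\bar f(x)=\sup\{f(y)\mid y\in[0,\infty)^S,\ y\le x\}$. Orders and suprema are componentwise. **Mann schemes.** A *Mann scheme* is a pair of real sequences $(\alpha_n)_{n\ge0}$ in $[0,1]$ and $(\beta_n)_{n\ge0}$ in $[0,1)$ with $\beta_n\to0$ and $\sum_n\beta_n=\infty$. It is *progressing* if $\beta_n/\alpha_n\to0$, where $0/0=0$ and $x/0=\infty$ for $x>0$. A *generalized Mann scheme* is a pair of sequences $(\alpha_n)$ in $[0,1]^S$, $(\beta_n)$ in $[0,1)^S$ each of whose components is a Mann scheme; it is *progressing* if $\beta_n(i)/\alpha_n(i)\to0$ for every $i\in S$ and there is a strictly increasing sequence $(m_k)_{k\ge 0}$ in $\mathbb N_0$ such that $U_k(i):=\{\ell\in\{m_k,\dots,m_{k+1}-1\}\mid\alpha_\ell(i)>0\}\neq\emptyset$ for all $k,i$ and, with $\ell_k(i):=\max U_k(i)$, $\sum_k\min_{i\in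 S}\beta_{\ell_k(i)}(i)=\infty$. A sequence $(x_n)$ in $[0,\infty)^S$ is *generated* by a (generalized) scheme on a sequence $(f_n)$ of operators if, componentwise and with arbitrary $x_0$, $$x_{n+1}=(1-\beta_n)\cdot\bigl(x_n+\alpha_n\cdot(f_n(x_n)-x_n)\bigr)\qquad(n\ge0).$$ **Statement.** Let $(G_n)$ be a sampling of an SSG $G$. Then for every $n$ the pointwise supremum $\sup_{k\ge n}f_{G_k}$ is finite, and in $[0,\infty]^S$ $$\lim_{n\to\infty}\mu\Bigl(\sup_{k\ge n}f_{G_k}\Bigr)=\mu f_G .$$ Moreover, for every progressing Mann scheme, and for every progressing generalized Mann scheme, every sequence $(x_n)$ that it generates on $(f_{G_n})$ converges to $\mu f_G$ in $[0,\infty]^S$. -/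

import Mathlib

open Filter Topology
open scoped NNReal ENNReal

noncomputable section

/-! ### Least fixpoints of operators on the non-negative orthant -/

/-- The extension of an operator `f` on `[0,∞)^S` to `[0,∞]^S`, given by
`x ↦ sup { f y | y ∈ [0,∞)^S, y ≤ x }` (componentwise supremum). -/
def omegaExtension {S : Type*} (f : (S → ℝ≥0) → (S → ℝ≥0)) :
    (S → ℝ≥0∞) →o (S → ℝ≥0∞) where
  toFun x s := ⨆ y : {y : S → ℝ≥0 // ∀ t, (y t : ℝ≥0∞) ≤ x t}, (f y.1 s : ℝ≥0∞)
  monotone' := fun _ _ hxx' s =>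
    iSup_le fun y => le_iSup_of_le
      (f := fun y : {y : S → ℝ≥0 // ∀ t, (y t : ℝ≥0∞) ≤ _} => (f y.1 s : ℝ≥0∞))
      ⟨y.1, fun t => (y.2 t).trans (hxx' t)⟩ le_rfl

/-- `μ f`: the least fixpoint in `[0,∞]^S` of the extension of `f`. -/
def leastFixpoint {S : Type*} (f : (S → ℝ≥0) → (S → ℝ≥0)) : S → ℝ≥0∞ :=
  OrderHom.lfp (omegaExtension f)

/-- `sup_{k ≥ n} f_k`, the pointwise supremum of a tail of a sequence of operators
(meaningful where the values are bounded above). -/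
def tailSup {S : Type*} (f : ℕ → (S → ℝ≥0) → (S → ℝ≥0)) (n : ℕ) :
    (S → ℝ≥0) → (S → ℝ≥0) :=
  fun v s => ⨆ k : {k : ℕ // n ≤ k}, f k.1 v s

/-! ### Dampened Mann schemes -/

/-- A dampened Mann scheme: learning rates `α` and dampening factors `β`. The learning rate `1`
(full updates) is allowed. -/
structure IsMannScheme (α β : ℕ → ℝ) : Prop where
  learning_mem : ∀ n, α n ∈ Set.Icc (0 : ℝ) 1
  dampening_mem : ∀ n, β n ∈ Set.Ico (0 : ℝ) 1
  dampening_tendsto : Tendsto β atTop (𝓝 0)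
  dampening_sum : Tendsto (fun N => ∑ n ∈ Finset.range N, β n) atTop atTop

/-- `β n / α n → 0`, with the conventions `0 / 0 = 0` and `x / 0 = ∞` for `x > 0`, which are
those of the division of `ℝ≥0∞`. -/
def QuotientVanishes (α β : ℕ → ℝ) : Prop :=
  Tendsto (fun n => ENNReal.ofReal (β n) / ENNReal.ofReal (α n)) atTop (𝓝 0)

/-- A progressing Mann scheme. -/
structure IsProgressingMannScheme (α β : ℕ → ℝ) : Prop extends IsMannScheme α β where
  quotient : QuotientVanishes α β

/-- A generalized Mann scheme: the parameters may depend on the component. -/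
def IsGeneralizedMannScheme {S : Type*} (α β : ℕ → S → ℝ) : Prop :=
  ∀ i, IsMannScheme (fun n => α n i) (fun n => β n i)

open Classical in
/-- The steps `ℓ ∈ {m k, …, m (k+1) - 1}` at which component `i` is updated. -/
def updateSteps {S : Type*} (α : ℕ → S → ℝ) (m : ℕ → ℕ) (k : ℕ) (i : S) : Finset ℕ :=
  (Finset.Ico (m k) (m (k + 1))).filter fun l => 0 < α l i

/-- A progressing generalized Mann scheme. The `max'` is the step of the last update of
component `i` in the `k`-th interval, and `⨅ i` is a minimum over the finitely many components. -/
structure IsProgressingGeneralizedMannScheme {S : Type*} [Fintype S] (α β : ℕ → S → ℝ) :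
    Prop where
  scheme : IsGeneralizedMannScheme α β
  quotient : ∀ i, QuotientVanishes (fun n => α n i) (fun n => β n i)
  fair : ∃ m : ℕ → ℕ, StrictMono m ∧
    ∃ hU : ∀ k i, (updateSteps α m k i).Nonempty,
      Tendsto (fun N => ∑ k ∈ Finset.range N,
        ⨅ i, β ((updateSteps α m k i).max' (hU k i)) i) atTop atTop

/-- `x` is a sequence generated by the scheme `(α, β)` on the operators `f n`, from the
(arbitrary) starting point `x 0`. -/
def GeneratedByScheme {S : Type*} (α β : ℕ → S → ℝ) (f : ℕ → (S → ℝ≥0) → (S → ℝ≥0))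
    (x : ℕ → S → ℝ≥0) : Prop :=
  ∀ n s, (x (n + 1) s : ℝ) =
    (1 - β n s) * ((x n s : ℝ) + α n s * ((f n (x n) s : ℝ) - (x n s : ℝ)))

/-- Convergence of a sequence in `[0,∞)^S` to a point of `[0,∞]^S`. -/
def ConvergesTo {S : Type*} (x : ℕ → S → ℝ≥0) (l : S → ℝ≥0∞) : Prop :=
  Tendsto (fun n s => (x n s : ℝ≥0∞)) atTop (𝓝 l)

/-! ### Simple stochastic games -/

/-- A simple stochastic game with finite state space `S` and actions in `A`. The states outside
`Smax` are those of the min-player; `T s a s'` is the probability of moving from `s` to `s'`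
under action `a`, and the game terminates with the remaining probability. -/
structure SSG (S A : Type*) [Fintype S] where
  enabled : S → Finset A
  T : S → A → S → ℝ≥0
  T_le_one : ∀ s a, ∑ s', T s a s' ≤ 1
  R : S → A → ℝ≥0
  Smax : Set S

namespace SSG

variable {S A : Type*} [Fintype S]

/-- Expected payoff of action `a` in state `s` with continuation values `v`. -/
def actionValue (G : SSG S A) (v : S → ℝ≥0) (s : S) (a : A) : ℝ≥0 :=
  G.R s a + ∑ s', G.T s a s' * v s'

open Classical in
/-- The Bellman operator; its value at final states (without enabled actions) is `0`. -/
def bellman (G : SSG S A) (v : S → ℝ≥0) (s : S) : ℝ≥0 :=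
  if h : (G.enabled s).Nonempty then
    if s ∈ G.Smax then (G.enabled s).sup' h (G.actionValue v s)
    else (G.enabled s).inf' h (G.actionValue v s)
  else 0

/-- `Gs` is a sampling of `G`. -/
structure IsSampling (G : SSG S A) (Gs : ℕ → SSG S A) : Prop where
  enabled_eq : ∀ n, (Gs n).enabled = G.enabled
  Smax_eq : ∀ n, (Gs n).Smax = G.Smax
  T_tendsto : ∀ s a s', Tendsto (fun n => (Gs n).T s a s') atTop (𝓝 (G.T s a s'))
  R_tendsto : ∀ s a, Tendsto (fun n => (Gs n).R s a) atTop (𝓝 (G.R s a))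
  T_zero : ∀ s a s', G.T s a s' = 0 → ∀ n, 1 ≤ n → (Gs n).T s a s' = 0
  R_zero : ∀ s a, G.R s a = 0 → ∀ n, 1 ≤ n → (Gs n).R s a = 0
  T_one : ∀ s a, ∑ s', G.T s a s' = 1 → ∀ n, 1 ≤ n → ∑ s', (Gs n).T s a s' = 1

end SSG

end

noncomputable section

/-! ### Pre-fixpoints and least fixpoints -/

section Fixpoint

variable {S : Type*}

/-! Bellman operators are monotone and nonexpansive, so everything reduces to pre-fixpoints. From
below, the liminf of the iterates is a pre-fixpoint of the limit operator
(`GeneratedByScheme.isPreFixpoint_liminf`), because `β/α → 0` makes dampening negligible against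
learning. From above, suppose almost all sampled operators share a pre-fixpoint `v`. An iterate
below `v + c` stays below it under the operator, and dampening shrinks the excess `c` by the factor
`1 - β`; divergence of `∑ β` removes the excess.

The crux is `IsSampling.exists_isPreFixpoint`: such a `v` exists within `ε` of `u = μ f_G`. Take `v
= u + ε w`, where `w` grows with the rank of `u s` among the values of `u`. An action that does not
increase a finite `u s` either stays in the level set of `u s` with reward zero and probability one,
which sampling preserves exactly, or lowers `w` strictly in expectation, and this slack absorbs the
sampling error. The same `v` bounds the least fixpoints of the tail suprema. -/

/-- `v ∈ [0,∞]^S` is a pre-fixpoint of the extension of `f`. -/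
def IsPreFixpoint (f : (S → ℝ≥0) → (S → ℝ≥0)) (v : S → ℝ≥0∞) : Prop :=
  ∀ y : S → ℝ≥0, (∀ t, (y t : ℝ≥0∞) ≤ v t) → ∀ s, (f y s : ℝ≥0∞) ≤ v s

/-- Monotone operators that increase by at most `c` when `c` is added to the argument. -/
structure IsMonotoneNonexpansive (f : (S → ℝ≥0) → (S → ℝ≥0)) : Prop where
  monotone : Monotone f
  add_const_le : ∀ (y : S → ℝ≥0) (c : ℝ≥0) (s : S), f (fun t => y t + c) s ≤ f y s + c

theorem IsPreFixpoint.leastFixpoint_le {f : (S → ℝ≥0) → (S → ℝ≥0)} {v : S → ℝ≥0∞}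
    (h : IsPreFixpoint f v) : leastFixpoint f ≤ v :=
  OrderHom.lfp_le _ fun s => iSup_le fun y => h y.1 y.2 s

theorem isPreFixpoint_leastFixpoint (f : (S → ℝ≥0) → (S → ℝ≥0)) :
    IsPreFixpoint f (leastFixpoint f) := by
  intro y hy s
  have h := congrFun (OrderHom.map_lfp (omegaExtension f)) s
  refine le_trans ?_ h.le
  exact le_iSup (fun y : {y : S → ℝ≥0 // ∀ t, (y t : ℝ≥0∞) ≤ leastFixpoint f t} =>
    (f y.1 s : ℝ≥0∞)) ⟨y, hy⟩

theorem leastFixpoint_mono {f g : (S → ℝ≥0) → (S → ℝ≥0)} (h : ∀ y s, f y s ≤ g y s) :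
    leastFixpoint f ≤ leastFixpoint g :=
  IsPreFixpoint.leastFixpoint_le fun y hy s =>
    (ENNReal.coe_le_coe.2 (h y s)).trans (isPreFixpoint_leastFixpoint g y hy s)

/-- Pre-fixpoints remain bounds after adding a constant. -/
theorem IsPreFixpoint.le_add_const {f : (S → ℝ≥0) → (S → ℝ≥0)} (hf : IsMonotoneNonexpansive f)
    {v : S → ℝ≥0∞} (hv : IsPreFixpoint f v) {x : S → ℝ≥0} {c : ℝ≥0}
    (hx : ∀ s, (x s : ℝ≥0∞) ≤ v s + c) (s : S) : (f x s : ℝ≥0∞) ≤ v s + c := by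
  have hne : ∀ t, min (x t : ℝ≥0∞) (v t) ≠ ⊤ := fun t =>
    ((min_le_left _ _).trans_lt ENNReal.coe_lt_top).ne
  -- Truncating `x` at `v` gives a finite point below `v` that is still within `c` of `x`.
  set y : S → ℝ≥0 := fun t => (min (x t : ℝ≥0∞) (v t)).toNNReal with hy
  have hyc : ∀ t, (y t : ℝ≥0∞) = min (x t : ℝ≥0∞) (v t) := fun t => ENNReal.coe_toNNReal (hne t)
  have hyv : ∀ t, (y t : ℝ≥0∞) ≤ v t := fun t => (hyc t).le.trans (min_le_right _ _)
  have hxy : x ≤ fun t => y t + c := by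
    intro t
    have : (x t : ℝ≥0∞) ≤ (y t : ℝ≥0∞) + c := by
      rw [hyc, min_add]
      exact le_min le_self_add (hx t)
    exact_mod_cast this
  have h1 : f x s ≤ f y s + c := (hf.monotone hxy s).trans (hf.add_const_le y c s)
  calc (f x s : ℝ≥0∞) ≤ ((f y s + c : ℝ≥0) : ℝ≥0∞) := ENNReal.coe_le_coe.2 h1
    _ = (f y s : ℝ≥0∞) + c := by push_cast; rfl
    _ ≤ v s + c := by gcongr; exact hv y hyv s

end Fixpoint

/-! ### Convergence of dampened Mann iterations -/

/-- Since `1 - a ≤ exp (-a)`, the product of `d n` with the exponential of the partial sum does not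
increase from `N` on. -/
theorem tendsto_zero_of_le_one_sub_mul {a d : ℕ → ℝ} {N : ℕ}
    (hsum : Tendsto (fun n => ∑ k ∈ Finset.range n, a k) atTop atTop) (hd : ∀ n, 0 ≤ d n)
    (h : ∀ n, N ≤ n → d (n + 1) ≤ (1 - a n) * d n) : Tendsto d atTop (𝓝 0) := by
  have key : ∀ n, N ≤ n → d n * Real.exp (∑ k ∈ Finset.range n, a k) ≤
      d N * Real.exp (∑ k ∈ Finset.range N, a k) := by
    intro n hn
    induction n, hn using Nat.le_induction with
    | base => exact le_rfl
    | succ n hn ih =>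
      refine le_trans ?_ ih
      rw [Finset.sum_range_succ, Real.exp_add]
      have h1 : (1 - a n) * Real.exp (a n) ≤ 1 := by
        have h2 : 1 - a n ≤ Real.exp (-a n) := by
          have := Real.add_one_le_exp (-a n); linarith
        calc (1 - a n) * Real.exp (a n) ≤ Real.exp (-a n) * Real.exp (a n) := by gcongr
          _ = 1 := by rw [← Real.exp_add]; simp
      have h3 : 0 ≤ d n * Real.exp (∑ k ∈ Finset.range n, a k) :=
        mul_nonneg (hd n) (Real.exp_pos _).le
      calc d (n + 1) * (Real.exp (∑ k ∈ Finset.range n, a k) * Real.exp (a n))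
          ≤ ((1 - a n) * d n) * (Real.exp (∑ k ∈ Finset.range n, a k) * Real.exp (a n)) := by
            gcongr; exact h n hn
        _ = (d n * Real.exp (∑ k ∈ Finset.range n, a k)) * ((1 - a n) * Real.exp (a n)) := by ring
        _ ≤ (d n * Real.exp (∑ k ∈ Finset.range n, a k)) * 1 := by gcongr
        _ = _ := mul_one _
  have hlim : Tendsto (fun n => (d N * Real.exp (∑ k ∈ Finset.range N, a k)) *
      Real.exp (-∑ k ∈ Finset.range n, a k)) atTop (𝓝 0) := by
    have := (Real.tendsto_exp_neg_atTop_nhds_zero.comp hsum).const_mul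
      (d N * Real.exp (∑ k ∈ Finset.range N, a k))
    simpa using this
  refine tendsto_of_tendsto_of_tendsto_of_le_of_le' tendsto_const_nhds hlim
    (Eventually.of_forall hd) ?_
  filter_upwards [eventually_ge_atTop N] with n hn
  rw [Real.exp_neg, ← div_eq_mul_inv, le_div_iff₀ (Real.exp_pos _)]
  exact key n hn

/-- The product form also covers `α n = 0`, where the convention `x / 0 = ∞` forces `β n = 0`. -/
theorem QuotientVanishes.eventually_le {α β : ℕ → ℝ} (h : QuotientVanishes α β)
    (hα : ∀ n, 0 ≤ α n) {δ : ℝ} (hδ : 0 < δ) : ∀ᶠ n in atTop, β n ≤ δ * α n := by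
  have h1 := h.eventually (gt_mem_nhds (ENNReal.ofReal_pos.2 hδ))
  filter_upwards [h1] with n hn
  have h2 := (ENNReal.div_le_iff_le_mul (Or.inr ENNReal.ofReal_ne_top)
    (Or.inl ENNReal.ofReal_ne_top)).1 hn.le
  rw [← ENNReal.ofReal_mul hδ.le] at h2
  exact (ENNReal.ofReal_le_ofReal_iff (mul_nonneg hδ.le (hα n))).1 h2

section Mann

variable {S : Type*} {α β : ℕ → S → ℝ} {f : ℕ → (S → ℝ≥0) → (S → ℝ≥0)} {x : ℕ → S → ℝ≥0}

/-- Averaging `x n` with `f n (x n)` stays below `v + c`, and `(1 - β) (v + c) ≤ v + (1 - β) c`. -/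
theorem GeneratedByScheme.succ_le (hx : GeneratedByScheme α β f x)
    (hsch : IsGeneralizedMannScheme α β) {n : ℕ} (hf : IsMonotoneNonexpansive (f n))
    {v : S → ℝ≥0∞} (hv : IsPreFixpoint (f n) v) {c : ℝ≥0}
    (hc : ∀ s, (x n s : ℝ≥0∞) ≤ v s + c) (s : S) :
    (x (n + 1) s : ℝ≥0∞) ≤ v s + ENNReal.ofReal ((1 - β n s) * c) := by
  obtain hvs | hvs := eq_or_ne (v s) ⊤
  · simp [hvs]
  have h1 := hc s
  have h2 := hv.le_add_const hf hc s
  lift v s to ℝ≥0 using hvs with w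
  obtain ⟨hα0, hα1⟩ := (hsch s).learning_mem n
  obtain ⟨hβ0, hβ1⟩ := (hsch s).dampening_mem n
  have h1' : (x n s : ℝ) ≤ w + c := by exact_mod_cast h1
  have h2' : (f n (x n) s : ℝ) ≤ w + c := by exact_mod_cast h2
  have h3 : (x (n + 1) s : ℝ) ≤ w + (1 - β n s) * c := by
    rw [hx n s]
    have h4 : (x n s : ℝ) + α n s * ((f n (x n) s : ℝ) - x n s) ≤ w + c := by nlinarith
    have h5 : 0 ≤ β n s * (w : ℝ) := mul_nonneg hβ0 (NNReal.coe_nonneg w)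
    calc (1 - β n s) * ((x n s : ℝ) + α n s * ((f n (x n) s : ℝ) - x n s))
        ≤ (1 - β n s) * (w + c) := mul_le_mul_of_nonneg_left h4 (by linarith)
      _ ≤ w + (1 - β n s) * c := by linarith
  rw [← ENNReal.ofReal_coe_nnreal, ← ENNReal.ofReal_coe_nnreal (p := w),
    ← ENNReal.ofReal_add (NNReal.coe_nonneg w)
      (mul_nonneg (by linarith) (NNReal.coe_nonneg c))]
  exact ENNReal.ofReal_le_ofReal h3

theorem GeneratedByScheme.succ_le_self (hx : GeneratedByScheme α β f x)
    (hsch : IsGeneralizedMannScheme α β) {n : ℕ} {s : S} (hα : ¬ 0 < α n s) :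
    x (n + 1) s ≤ x n s := by
  have h0 : α n s = 0 := le_antisymm (not_lt.1 hα) ((hsch s).learning_mem n).1
  have hβ := ((hsch s).dampening_mem n).1
  have : (x (n + 1) s : ℝ) ≤ x n s := by
    rw [hx n s, h0]
    have := mul_nonneg hβ (NNReal.coe_nonneg (x n s))
    linarith
  exact_mod_cast this

theorem GeneratedByScheme.le_of_le (hx : GeneratedByScheme α β f x)
    (hsch : IsGeneralizedMannScheme α β) {N : ℕ}
    (hf : ∀ n, IsMonotoneNonexpansive (f n)) {v : S → ℝ≥0∞}
    (hv : ∀ n, N ≤ n → IsPreFixpoint (f n) v) {c : ℝ≥0} {m : ℕ} (hm : N ≤ m)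
    (hc : ∀ s, (x m s : ℝ≥0∞) ≤ v s + c) {n : ℕ} (hn : m ≤ n) (s : S) :
    (x n s : ℝ≥0∞) ≤ v s + c := by
  induction n, hn using Nat.le_induction generalizing s with
  | base => exact hc s
  | succ n hn ih =>
    refine (hx.succ_le hsch (hf n) (hv n (hm.trans hn)) ih s).trans ?_
    gcongr
    refine ENNReal.ofReal_le_of_le_toReal ?_
    have hβ := ((hsch s).dampening_mem n).1
    have := mul_nonneg hβ (NNReal.coe_nonneg c)
    simp only [ENNReal.coe_toReal]
    linarith

/-- If the iterates are eventually above `y`, up to `ε`, then they are eventually above the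
limit of `f n y`, up to a multiple of `ε`. -/
theorem GeneratedByScheme.eventually_le_add (hx : GeneratedByScheme α β f x)
    (hsch : IsGeneralizedMannScheme α β)
    (hquot : ∀ i, QuotientVanishes (fun n => α n i) (fun n => β n i))
    (hf : ∀ n, IsMonotoneNonexpansive (f n)) {y z : S → ℝ≥0} {ε : ℝ≥0} (hε : 0 < ε)
    (hz : ∀ s, Tendsto (fun n => f n y s) atTop (𝓝 (z s)))
    (hy : ∀ᶠ n in atTop, ∀ s, y s ≤ x n s + ε) (s : S) :
    ∀ᶠ n in atTop, z s ≤ x n s + 4 * ε := by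
  have hε' : (0 : ℝ) < ε := NNReal.coe_pos.2 hε
  have hα : ∀ n, 0 ≤ α n s := fun n => ((hsch s).learning_mem n).1
  have hzR : Tendsto (fun n => (f n y s : ℝ)) atTop (𝓝 (z s : ℝ)) :=
    NNReal.tendsto_coe.2 (hz s)
  have hfx : ∀ᶠ n in atTop, (z s : ℝ) - 2 * ε ≤ f n (x n) s := by
    filter_upwards [hy, hzR.eventually (lt_mem_nhds (show (z s : ℝ) - ε < z s by linarith))]
      with n hn hn'
    have h1 : f n y s ≤ f n (x n) s + ε :=
      ((hf n).monotone (fun t => hn t) s).trans ((hf n).add_const_le (x n) ε s)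
    have h1' : (f n y s : ℝ) ≤ f n (x n) s + ε := by exact_mod_cast h1
    linarith
  -- Chosen so that the loss `β (z + 1)` is at most `α ε / 2`; with `β < 1 / 2` this is at most `(1
  -- - β) α ε`.
  have hδ : (0 : ℝ) < ε / (2 * (z s + 1)) := by positivity
  have hβ2 : ∀ᶠ n in atTop, β n s < 1 / 2 :=
    (hsch s).dampening_tendsto.eventually (gt_mem_nhds (by norm_num))
  obtain ⟨N, hN⟩ := eventually_atTop.1 (hfx.and (hβ2.and
    (((hquot s).eventually_le hα hδ).and ((hquot s).eventually_le hα one_pos))))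
  -- The operator values are at least `z - 2 ε = w + ε`; the spare `ε` pays for the dampening of
  -- `w`, so the deficit below `w` contracts by `1 - β`.
  set w : ℝ := z s - 3 * ε with hw
  have hlim : Tendsto (fun n => max (w - x n s) 0) atTop (𝓝 0) := by
    refine tendsto_zero_of_le_one_sub_mul (N := N) (hsch s).dampening_sum
      (fun n => le_max_right _ _) fun n hn => ?_
    obtain ⟨h1, h2, h3, h4⟩ := hN n hn
    have hα0 := hα n
    have hα1 := ((hsch s).learning_mem n).2
    have hβ0 := ((hsch s).dampening_mem n).1
    have hβ1 := ((hsch s).dampening_mem n).2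
    have h5 : β n s * (z s + 1) ≤ α n s * ε / 2 := by
      calc β n s * (z s + 1) ≤ ε / (2 * (z s + 1)) * α n s * (z s + 1) := by gcongr
        _ = α n s * ε / 2 := by field_simp
    have h6 : β n s * w ≤ (1 - β n s) * (α n s * ε) := by
      have h7 : β n s * w ≤ β n s * (z s + 1) :=
        mul_le_mul_of_nonneg_left (by linarith) hβ0
      have h8 : 0 ≤ α n s * ε := mul_nonneg hα0 hε'.le
      nlinarith
    have h9 : (1 - β n s) * (α n s * (w + ε)) ≤ (1 - β n s) * (α n s * f n (x n) s) := by
      gcongr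
      linarith
    have h10 : w - x (n + 1) s ≤ (1 - β n s) * ((1 - α n s) * (w - x n s)) := by
      rw [hx n s]
      nlinarith
    refine max_le (h10.trans ?_) (mul_nonneg (by linarith) (le_max_right _ _))
    refine mul_le_mul_of_nonneg_left ?_ (by linarith)
    calc (1 - α n s) * (w - x n s) ≤ (1 - α n s) * max (w - x n s) 0 :=
          mul_le_mul_of_nonneg_left (le_max_left _ _) (by linarith)
      _ ≤ 1 * max (w - x n s) 0 :=
          mul_le_mul_of_nonneg_right (by linarith) (le_max_right _ _)
      _ = _ := one_mul _
  filter_upwards [hlim.eventually (gt_mem_nhds hε')] with n hn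
  have h1 := (le_max_left _ _).trans_lt hn
  have : (z s : ℝ) ≤ x n s + 4 * ε := by linarith
  exact_mod_cast this

variable [Fintype S]

theorem exists_forall_le_add_const (y : S → ℝ≥0) (v : S → ℝ≥0∞) :
    ∃ c : ℝ≥0, ∀ s, (y s : ℝ≥0∞) ≤ v s + c :=
  ⟨∑ s, y s, fun s => le_add_left (ENNReal.coe_le_coe.2
    (Finset.single_le_sum (fun _ _ => zero_le) (Finset.mem_univ s)))⟩

/-- Iterates of a scalar Mann scheme are eventually below any common pre-fixpoint, up to `ε`. -/
theorem GeneratedByScheme.eventually_le_of_scalar {α β : ℕ → ℝ}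
    (hx : GeneratedByScheme (fun n (_ : S) => α n) (fun n _ => β n) f x)
    (hsch : IsMannScheme α β) {N : ℕ} (hf : ∀ n, IsMonotoneNonexpansive (f n)) {v : S → ℝ≥0∞}
    (hv : ∀ n, N ≤ n → IsPreFixpoint (f n) v) {ε : ℝ≥0} (hε : 0 < ε) :
    ∀ᶠ n in atTop, ∀ s, (x n s : ℝ≥0∞) ≤ v s + ε := by
  obtain ⟨c, hc⟩ := exists_forall_le_add_const (x N) v
  have hβ : ∀ n, 0 ≤ 1 - β n := fun n => by linarith [(hsch.dampening_mem n).2]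
  let d : ℕ → ℝ≥0 := fun n => c * ∏ k ∈ Finset.Ico N n, (1 - β k).toNNReal
  have hd : ∀ n, N ≤ n → (d (n + 1) : ℝ) = (1 - β n) * d n := by
    intro n hn
    simp only [d, Finset.prod_Ico_succ_top hn, NNReal.coe_mul, Real.coe_toNNReal _ (hβ n)]
    ring
  have hle : ∀ n, N ≤ n → ∀ s, (x n s : ℝ≥0∞) ≤ v s + d n := by
    intro n hn
    induction n, hn using Nat.le_induction with
    | base => simpa [d] using hc
    | succ n hn ih =>
      intro s
      have := hx.succ_le (fun _ => hsch) (hf n) (hv n hn) ih s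
      rwa [← hd n hn, ENNReal.ofReal_coe_nnreal] at this
  have hlim : Tendsto (fun n => (d n : ℝ)) atTop (𝓝 0) :=
    tendsto_zero_of_le_one_sub_mul hsch.dampening_sum
      (fun n => (d n).2) (fun n hn => (hd n hn).le)
  filter_upwards [hlim.eventually (gt_mem_nhds (NNReal.coe_pos.2 hε)), eventually_ge_atTop N]
    with n hn hNn s
  refine (hle n hNn s).trans ?_
  gcongr
  exact_mod_cast hn.le

/-- Iterates of a progressing generalized Mann scheme are eventually below any common
pre-fixpoint, up to `ε`. -/
theorem GeneratedByScheme.eventually_le (hx : GeneratedByScheme α β f x)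
    (hsch : IsProgressingGeneralizedMannScheme α β) {N : ℕ}
    (hf : ∀ n, IsMonotoneNonexpansive (f n)) {v : S → ℝ≥0∞}
    (hv : ∀ n, N ≤ n → IsPreFixpoint (f n) v) {ε : ℝ≥0} (hε : 0 < ε) :
    ∀ᶠ n in atTop, ∀ s, (x n s : ℝ≥0∞) ≤ v s + ε := by
  obtain hS | hS := isEmpty_or_nonempty S
  · exact Eventually.of_forall fun _ s => hS.elim s
  obtain ⟨m, hm, hU, hsum⟩ := hsch.fair
  -- Only the dampening at the last update of a component counts: a later update could undo an
  -- earlier decrease.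
  set b : ℕ → ℝ := fun k => ⨅ i, β ((updateSteps α m k i).max' (hU k i)) i with hb
  have hble : ∀ k i, b k ≤ β ((updateSteps α m k i).max' (hU k i)) i := fun k i =>
    ciInf_le (Set.finite_range _).bddBelow i
  have hb1 : ∀ k, 0 ≤ 1 - b k := fun k => by
    have := (hble k hS.some).trans ((hsch.scheme hS.some).dampening_mem _).2.le
    linarith
  have hNm : ∀ k, N ≤ k → N ≤ m k := fun k hk => hk.trans (hm.id_le k)
  obtain ⟨c, hc⟩ := exists_forall_le_add_const (x (m N)) v
  let d : ℕ → ℝ≥0 := fun n => c * ∏ k ∈ Finset.Ico N n, (1 - b k).toNNReal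
  have hd : ∀ n, N ≤ n → (d (n + 1) : ℝ) = (1 - b n) * d n := by
    intro n hn
    simp only [d, Finset.prod_Ico_succ_top hn, NNReal.coe_mul, Real.coe_toNNReal _ (hb1 n)]
    ring
  have hle : ∀ k, N ≤ k → ∀ s, (x (m k) s : ℝ≥0∞) ≤ v s + d k := by
    intro k hk
    induction k, hk using Nat.le_induction with
    | base => simpa [d] using hc
    | succ k hk ih =>
      intro s
      set l := (updateSteps α m k s).max' (hU k s) with hl
      have hlmem : l ∈ updateSteps α m k s := Finset.max'_mem _ _
      have hl' : m k ≤ l ∧ l < m (k + 1) := by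
        have := (Finset.mem_filter.1 hlmem).1
        simpa using this
      have h1 : (x (l + 1) s : ℝ≥0∞) ≤ v s + d (k + 1) := by
        refine (hx.succ_le hsch.scheme (hf l) (hv l ((hNm k hk).trans hl'.1))
          (hx.le_of_le hsch.scheme hf hv (hNm k hk) ih hl'.1) s).trans ?_
        rw [← ENNReal.ofReal_coe_nnreal (p := d (k + 1)), hd k hk]
        gcongr
        exact hble k s
      -- After its last update in the interval the component has learning rate zero and cannot grow.
      have h2 : ∀ n, l + 1 ≤ n → n ≤ m (k + 1) → x n s ≤ x (l + 1) s := by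
        intro n hn
        induction n, hn using Nat.le_induction with
        | base => exact fun _ => le_rfl
        | succ n hn ih' =>
          intro hnm
          refine (hx.succ_le_self hsch.scheme fun hα => ?_).trans (ih' (by omega))
          have hmem : n ∈ updateSteps α m k s :=
            Finset.mem_filter.2 ⟨Finset.mem_Ico.2 ⟨by omega, by omega⟩, hα⟩
          have := Finset.le_max' _ _ hmem
          omega
      exact (ENNReal.coe_le_coe.2 (h2 _ hl'.2 le_rfl)).trans h1
  have hlim : Tendsto (fun n => (d n : ℝ)) atTop (𝓝 0) :=
    tendsto_zero_of_le_one_sub_mul hsum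
      (fun n => (d n).2) (fun n hn => (hd n hn).le)
  obtain ⟨k, hk, hNk⟩ := ((hlim.eventually (gt_mem_nhds (NNReal.coe_pos.2 hε))).and
    (eventually_ge_atTop N)).exists
  filter_upwards [eventually_ge_atTop (m k)] with n hn s
  refine (hx.le_of_le hsch.scheme hf hv (hNm k hNk) (hle k hNk) hn s).trans ?_
  gcongr
  exact_mod_cast hk.le

/-- The lower limit of the iterates is a pre-fixpoint of the limit operator. -/
theorem GeneratedByScheme.isPreFixpoint_liminf (hx : GeneratedByScheme α β f x)
    (hsch : IsGeneralizedMannScheme α β)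
    (hquot : ∀ i, QuotientVanishes (fun n => α n i) (fun n => β n i))
    (hf : ∀ n, IsMonotoneNonexpansive (f n)) {g : (S → ℝ≥0) → (S → ℝ≥0)}
    (hg : ∀ y s, Tendsto (fun n => f n y s) atTop (𝓝 (g y s))) :
    IsPreFixpoint g (fun s => liminf (fun n => (x n s : ℝ≥0∞)) atTop) := by
  intro y hy s
  refine ENNReal.le_of_forall_pos_le_add fun η hη _ => ?_
  have hη4 : 0 < η / 4 := by positivity
  have hev : ∀ᶠ n in atTop, ∀ t, y t ≤ x n t + η / 4 := by
    refine eventually_all.2 fun t => ?_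
    -- For `y t ≠ 0`, subtracting `η / 4` gives a value strictly below the liminf, hence eventually
    -- below the iterates.
    obtain h0 | h0 := eq_or_ne (y t) 0
    · exact Eventually.of_forall fun n => by simp [h0]
    have hlt : ((y t - η / 4 : ℝ≥0) : ℝ≥0∞) < liminf (fun n => (x n t : ℝ≥0∞)) atTop :=
      lt_of_lt_of_le (ENNReal.coe_lt_coe.2 (tsub_lt_self (pos_iff_ne_zero.2 h0) hη4)) (hy t)
    filter_upwards [eventually_lt_of_lt_liminf hlt] with n hn
    exact tsub_le_iff_right.1 (ENNReal.coe_lt_coe.1 hn).le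
  have h1 := hx.eventually_le_add hsch hquot hf hη4 (hg y) hev s
  have h2 : ((g y s : ℝ≥0∞) - η) ≤ liminf (fun n => (x n s : ℝ≥0∞)) atTop := by
    refine le_liminf_of_le (by isBoundedDefault) ?_
    filter_upwards [h1] with n hn
    rw [mul_div_cancel₀ η (by norm_num : (4 : ℝ≥0) ≠ 0)] at hn
    exact tsub_le_iff_right.2 (by exact_mod_cast hn)
  exact tsub_le_iff_right.1 h2

/-- Convergence to the least fixpoint, given approximate common pre-fixpoints. -/
theorem GeneratedByScheme.convergesTo (hx : GeneratedByScheme α β f x)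
    (hsch : IsGeneralizedMannScheme α β)
    (hquot : ∀ i, QuotientVanishes (fun n => α n i) (fun n => β n i))
    (hf : ∀ n, IsMonotoneNonexpansive (f n)) {g : (S → ℝ≥0) → (S → ℝ≥0)}
    (hg : ∀ y s, Tendsto (fun n => f n y s) atTop (𝓝 (g y s)))
    (hup : ∀ ε : ℝ≥0, 0 < ε → ∀ᶠ n in atTop, ∀ s, (x n s : ℝ≥0∞) ≤ leastFixpoint g s + ε) :
    ConvergesTo x (leastFixpoint g) := by
  refine tendsto_pi_nhds.2 fun s => tendsto_of_le_liminf_of_limsup_le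
    ((hx.isPreFixpoint_liminf hsch hquot hf hg).leastFixpoint_le s) ?_
  refine ENNReal.le_of_forall_pos_le_add fun ε hε _ => ?_
  refine limsup_le_of_le (by isBoundedDefault) ?_
  filter_upwards [hup ε hε] with n hn using hn s

end Mann

/-! ### Bellman operators -/

namespace SSG

variable {S A : Type*} [Fintype S]

theorem actionValue_mono (G : SSG S A) {v w : S → ℝ≥0} (h : v ≤ w) (s : S) (a : A) :
    G.actionValue v s a ≤ G.actionValue w s a := by
  unfold actionValue
  gcongr with t
  exact h t

theorem actionValue_add_const_le (G : SSG S A) (v : S → ℝ≥0) (c : ℝ≥0) (s : S) (a : A) :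
    G.actionValue (fun t => v t + c) s a ≤ G.actionValue v s a + c := by
  simp only [actionValue, mul_add, Finset.sum_add_distrib, ← Finset.sum_mul, add_assoc]
  gcongr
  exact mul_le_of_le_one_left zero_le (G.T_le_one s a)

theorem bellman_of_empty (G : SSG S A) {s : S} (h : ¬ (G.enabled s).Nonempty) (v : S → ℝ≥0) :
    G.bellman v s = 0 := by
  rw [bellman, dif_neg h]

theorem bellman_of_mem (G : SSG S A) {s : S} (h : (G.enabled s).Nonempty) (hs : s ∈ G.Smax)
    (v : S → ℝ≥0) : G.bellman v s = (G.enabled s).sup' h (G.actionValue v s) := by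
  rw [bellman, dif_pos h, if_pos hs]

theorem bellman_of_notMem (G : SSG S A) {s : S} (h : (G.enabled s).Nonempty) (hs : s ∉ G.Smax)
    (v : S → ℝ≥0) : G.bellman v s = (G.enabled s).inf' h (G.actionValue v s) := by
  rw [bellman, dif_pos h, if_neg hs]

theorem isMonotoneNonexpansive_bellman (G : SSG S A) : IsMonotoneNonexpansive G.bellman := by
  constructor
  · intro v w hvw s
    by_cases h : (G.enabled s).Nonempty
    · by_cases hs : s ∈ G.Smax
      · rw [G.bellman_of_mem h hs, G.bellman_of_mem h hs]
        exact Finset.sup'_mono_fun fun a _ => G.actionValue_mono hvw s a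
      · rw [G.bellman_of_notMem h hs, G.bellman_of_notMem h hs]
        exact Finset.inf'_mono_fun fun a _ => G.actionValue_mono hvw s a
    · simp [G.bellman_of_empty h]
  · intro v c s
    by_cases h : (G.enabled s).Nonempty
    · by_cases hs : s ∈ G.Smax
      · rw [G.bellman_of_mem h hs, G.bellman_of_mem h hs]
        refine Finset.sup'_le _ _ fun a ha => (G.actionValue_add_const_le v c s a).trans ?_
        gcongr
        exact Finset.le_sup' (G.actionValue v s) ha
      · rw [G.bellman_of_notMem h hs, G.bellman_of_notMem h hs]
        obtain ⟨a, ha, hav⟩ := Finset.exists_mem_eq_inf' h (G.actionValue v s)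
        rw [hav]
        exact (Finset.inf'_le _ ha).trans (G.actionValue_add_const_le v c s a)
    · simp [G.bellman_of_empty h]

/-- `actionValue` with continuation values in `[0,∞]`. -/
def extActionValue (G : SSG S A) (v : S → ℝ≥0∞) (s : S) (a : A) : ℝ≥0∞ :=
  G.R s a + ∑ s', (G.T s a s' : ℝ≥0∞) * v s'

theorem extActionValue_coe (G : SSG S A) (v : S → ℝ≥0) (s : S) (a : A) :
    G.extActionValue (fun t => v t) s a = G.actionValue v s a := by
  simp [extActionValue, actionValue]

theorem extActionValue_mono (G : SSG S A) {v w : S → ℝ≥0∞} (h : v ≤ w) (s : S) (a : A) :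
    G.extActionValue v s a ≤ G.extActionValue w s a := by
  unfold extActionValue
  gcongr with t
  exact h t

/-- Truncations are finite, so the pre-fixpoint property applies to them; the limit carries it to
values in `[0,∞]`. -/
theorem tendsto_actionValue_min (G : SSG S A) (u : S → ℝ≥0∞) (s : S) (a : A) :
    Tendsto (fun j : ℕ => (G.actionValue (fun t => (min (u t) j).toNNReal) s a : ℝ≥0∞)) atTop
      (𝓝 (G.extActionValue u s a)) := by
  have h : ∀ j : ℕ, (G.actionValue (fun t => (min (u t) j).toNNReal) s a : ℝ≥0∞) =
      G.extActionValue (fun t => min (u t) j) s a := by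
    intro j
    rw [← extActionValue_coe]
    congr 1
    funext t
    exact ENNReal.coe_toNNReal ((min_le_right _ _).trans_lt (ENNReal.natCast_lt_top j)).ne
  simp only [h, extActionValue]
  refine tendsto_const_nhds.add (tendsto_finsetSum _ fun t _ => ?_)
  refine ENNReal.Tendsto.const_mul ?_ (Or.inr ENNReal.coe_ne_top)
  have := (tendsto_const_nhds (x := u t)).min ENNReal.tendsto_nat_nhds_top
  simpa using this

/-- A pre-fixpoint bounds the values of all actions of the max-player. -/
theorem extActionValue_le_of_mem (G : SSG S A) {u : S → ℝ≥0∞} (hu : IsPreFixpoint G.bellman u)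
    {s : S} (hs : s ∈ G.Smax) {a : A} (ha : a ∈ G.enabled s) : G.extActionValue u s a ≤ u s := by
  refine le_of_tendsto' (G.tendsto_actionValue_min u s a) fun j => ?_
  refine le_trans ?_ (hu (fun t => (min (u t) j).toNNReal)
    (fun t => ENNReal.coe_toNNReal_le_self.trans (min_le_left _ _)) s)
  rw [G.bellman_of_mem ⟨a, ha⟩ hs]
  exact ENNReal.coe_le_coe.2 (Finset.le_sup' (G.actionValue _ s) ha)

/-- A pre-fixpoint bounds the value of some action of the min-player. -/
theorem exists_extActionValue_le (G : SSG S A) {u : S → ℝ≥0∞} (hu : IsPreFixpoint G.bellman u)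
    {s : S} (hs : s ∉ G.Smax) (hne : (G.enabled s).Nonempty) :
    ∃ a ∈ G.enabled s, G.extActionValue u s a ≤ u s := by
  by_contra! hcon
  -- As there are finitely many actions, one truncation level refutes all of them at once.
  have hev : ∀ᶠ j : ℕ in atTop, ∀ a ∈ G.enabled s,
      u s < (G.actionValue (fun t => (min (u t) j).toNNReal) s a : ℝ≥0∞) :=
    (eventually_all_finset _).2 fun a ha =>
      (G.tendsto_actionValue_min u s a).eventually (lt_mem_nhds (hcon a ha))
  obtain ⟨j, hj⟩ := hev.exists
  have h := hu (fun t => (min (u t) j).toNNReal)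
    (fun t => ENNReal.coe_toNNReal_le_self.trans (min_le_left _ _)) s
  rw [G.bellman_of_notMem hne hs] at h
  obtain ⟨a, ha, hav⟩ := Finset.exists_mem_eq_inf' hne
    (G.actionValue (fun t => (min (u t) j).toNNReal) s)
  rw [hav] at h
  exact (hj a ha).not_ge h

/-! ### Perturbed fixpoints -/

/-- A bounded weight that increases strictly with the value of `u`. -/
def rankWeight (u : S → ℝ≥0∞) (c : ℝ≥0) (s : S) : ℝ≥0 :=
  open Classical in 1 - c ^ ((Finset.univ.filter fun t => u t < u s).card + 1)

theorem rankWeight_congr {u : S → ℝ≥0∞} (c : ℝ≥0) {s t : S} (h : u s = u t) :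
    rankWeight u c s = rankWeight u c t := by
  simp only [rankWeight, h]

/-- Finitely many positive transition and termination probabilities have a common positive strict
lower bound. -/
theorem exists_lt_transition (G : SSG S A) : ∃ c : ℝ≥0, 0 < c ∧ c < 1 ∧
    ∀ s, ∀ a ∈ G.enabled s, (∀ t, G.T s a t ≠ 0 → c < G.T s a t) ∧
      (∑ t, G.T s a t ≠ 1 → c < 1 - ∑ t, G.T s a t) := by
  have hlt : ∀ r : ℝ≥0, 0 < r → ∀ᶠ c in 𝓝[>] (0 : ℝ≥0), c < r := fun r hr =>
    mem_nhdsWithin_of_mem_nhds (gt_mem_nhds hr)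
  have h : ∀ᶠ c in 𝓝[>] (0 : ℝ≥0), ∀ s, ∀ a ∈ G.enabled s,
      (∀ t, G.T s a t ≠ 0 → c < G.T s a t) ∧
      (∑ t, G.T s a t ≠ 1 → c < 1 - ∑ t, G.T s a t) := by
    refine eventually_all.2 fun s => (eventually_all_finset _).2 fun a _ => ?_
    refine (eventually_all.2 fun t => ?_).and ?_
    · exact eventually_imp_distrib_left.2 fun h => hlt _ (pos_iff_ne_zero.2 h)
    · exact eventually_imp_distrib_left.2 fun h =>
        hlt _ (tsub_pos_of_lt (lt_of_le_of_ne (G.T_le_one s a) h))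
  obtain ⟨c, ⟨h0, h1⟩, h2⟩ := ((eventually_mem_nhdsWithin.and (hlt 1 one_pos)).and h).exists
  exact ⟨c, h0, h1, h2⟩

theorem ne_top_of_extActionValue_le (G : SSG S A) {u : S → ℝ≥0∞} {s : S} {a : A} (hus : u s ≠ ⊤)
    (hua : G.extActionValue u s a ≤ u s) {t : S} (ht : G.T s a t ≠ 0) : u t ≠ ⊤ := by
  intro htop
  refine hus (top_le_iff.1 (le_trans ?_ hua))
  have h1 : (G.T s a t : ℝ≥0∞) * u t ≤ ∑ t, (G.T s a t : ℝ≥0∞) * u t :=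
    Finset.single_le_sum (f := fun t => (G.T s a t : ℝ≥0∞) * u t)
      (fun _ _ => zero_le) (Finset.mem_univ t)
  rw [htop, ENNReal.mul_top (by simpa using ht)] at h1
  exact h1.trans le_add_self

theorem extActionValue_eq_coe (G : SSG S A) {v : S → ℝ≥0∞} {s : S} {a : A}
    (hv : ∀ t, G.T s a t ≠ 0 → v t ≠ ⊤) :
    G.extActionValue v s a = G.actionValue (fun t => (v t).toNNReal) s a := by
  rw [← extActionValue_coe, extActionValue, extActionValue]
  congr 1
  refine Finset.sum_congr rfl fun t _ => ?_
  by_cases ht : G.T s a t = 0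
  · simp [ht]
  · rw [ENNReal.coe_toNNReal (hv t ht)]

/-- An action that does not increase `u` either moves inside a level set of `u` with probability
one and reward zero, or decreases the rank weight strictly. -/
theorem level_or_sum_rankWeight_lt (G : SSG S A) {u : S → ℝ≥0∞} {s : S} {a : A} (hus : u s ≠ ⊤)
    (hua : G.extActionValue u s a ≤ u s) {c : ℝ≥0} (hc0 : 0 < c) (hc1 : c < 1)
    (hcT : ∀ t, G.T s a t ≠ 0 → c < G.T s a t)
    (hcsum : ∑ t, G.T s a t ≠ 1 → c < 1 - ∑ t, G.T s a t) :
    (∑ t, G.T s a t = 1 ∧ G.R s a = 0 ∧ ∀ t, G.T s a t ≠ 0 → u t = u s) ∨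
      ∑ t, G.T s a t * rankWeight u c t < rankWeight u c s := by
  classical
  have hpow : ∀ n : ℕ, c ^ n ≤ 1 := fun n => pow_le_one' hc1.le n
  have hw1 : ∀ t, rankWeight u c t ≤ 1 := fun t => tsub_le_self
  have hws : (rankWeight u c s : ℝ) =
      1 - (c : ℝ) ^ ((Finset.univ.filter fun t => u t < u s).card + 1) := by
    rw [rankWeight, NNReal.coe_sub (hpow _)]; push_cast; rfl
  by_cases hT : ∑ t, G.T s a t = 1
  swap
  -- Termination has probability above `c`, so the expected weight is below `1 - c`, and every
  -- weight is at least `1 - c`.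
  · right
    have h1 : ∑ t, G.T s a t * rankWeight u c t ≤ ∑ t, G.T s a t :=
      Finset.sum_le_sum fun t _ => mul_le_of_le_one_right zero_le (hw1 t)
    refine h1.trans_lt ?_
    have h2 := hcsum hT
    rw [lt_tsub_iff_left] at h2
    have h3 : c ^ ((Finset.univ.filter fun t => u t < u s).card + 1) ≤ c :=
      pow_le_of_le_one zero_le hc1.le (by omega)
    rw [rankWeight, lt_tsub_iff_right]
    exact (add_le_add_right h3 _).trans_lt h2
  by_cases hlow : ∃ t, G.T s a t ≠ 0 ∧ u t < u s
  · right
    -- With `r` the rank of `s`, the weight of `t₀` is at most `1 - c ^ r`. It is reached with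
    -- probability above `c`, so the expected weight falls below `1 - c ^ (r + 1)`.
    obtain ⟨t₀, ht₀, hlt⟩ := hlow
    set r := (Finset.univ.filter fun t => u t < u s).card with hr
    have hrank : (Finset.univ.filter fun t => u t < u t₀).card + 1 ≤ r := by
      refine Finset.card_lt_card ?_
      refine Finset.ssubset_iff_subset_ne.2 ⟨fun t ht => ?_, fun h => ?_⟩
      · simp only [Finset.mem_filter, Finset.mem_univ, true_and] at ht ⊢
        exact ht.trans hlt
      · have : t₀ ∈ Finset.univ.filter fun t => u t < u s := by simpa using hlt
        rw [← h] at this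
        simp at this
    have hw0 : rankWeight u c t₀ + c ^ r ≤ 1 := by
      have h1 : c ^ r ≤ c ^ ((Finset.univ.filter fun t => u t < u t₀).card + 1) :=
        pow_le_pow_of_le_one zero_le hc1.le hrank
      calc rankWeight u c t₀ + c ^ r
          ≤ rankWeight u c t₀ + c ^ ((Finset.univ.filter fun t => u t < u t₀).card + 1) := by
            gcongr
        _ = 1 := tsub_add_cancel_of_le (hpow _)
    have h2 : ∑ t, G.T s a t * rankWeight u c t + G.T s a t₀ * c ^ r ≤ 1 := by
      rw [← Finset.add_sum_erase _ _ (Finset.mem_univ t₀)]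
      calc G.T s a t₀ * rankWeight u c t₀ +
            ∑ t ∈ Finset.univ.erase t₀, G.T s a t * rankWeight u c t + G.T s a t₀ * c ^ r
          = G.T s a t₀ * (rankWeight u c t₀ + c ^ r) +
            ∑ t ∈ Finset.univ.erase t₀, G.T s a t * rankWeight u c t := by ring
        _ ≤ G.T s a t₀ * 1 + ∑ t ∈ Finset.univ.erase t₀, G.T s a t * 1 := by
            gcongr with t _
            exact hw1 t
        _ = 1 := by
            simp only [mul_one]
            rw [Finset.add_sum_erase _ _ (Finset.mem_univ t₀), hT]
    have h3 : c ^ (r + 1) < G.T s a t₀ * c ^ r := by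
      rw [pow_succ, mul_comm]
      exact mul_lt_mul_of_pos_right (hcT t₀ ht₀) (pow_pos hc0 r)
    rw [rankWeight, ← hr, lt_tsub_iff_right]
    exact (add_lt_add_right h3 _).trans_le h2
  -- All successors lie at or above `u s`, yet their mean plus the reward is at most `u s`: equality
  -- holds throughout.
  · left
    push Not at hlow
    have hfin : ∀ t, G.T s a t ≠ 0 → u t ≠ ⊤ := fun t =>
      G.ne_top_of_extActionValue_le hus hua
    have hle : G.R s a + ∑ t, G.T s a t * (u t).toNNReal ≤ (u s).toNNReal := by
      rw [← ENNReal.coe_le_coe, ENNReal.coe_toNNReal hus]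
      exact (G.extActionValue_eq_coe hfin).symm.le.trans hua
    have hge : ∀ t, G.T s a t * (u s).toNNReal ≤ G.T s a t * (u t).toNNReal := by
      intro t
      by_cases ht : G.T s a t = 0
      · simp [ht]
      · gcongr
        · exact hfin t ht
        · exact hlow t ht
    have hsum : ∑ t, G.T s a t * (u s).toNNReal = (u s).toNNReal := by
      rw [← Finset.sum_mul, hT, one_mul]
    have hsle : (u s).toNNReal ≤ ∑ t, G.T s a t * (u t).toNNReal :=
      hsum.symm.le.trans (Finset.sum_le_sum fun t _ => hge t)
    refine ⟨hT, ?_, fun t ht => ?_⟩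
    · have h1 : G.R s a + (u s).toNNReal ≤ 0 + (u s).toNNReal := by
        rw [zero_add]
        exact (add_le_add_right hsle _).trans hle
      exact le_antisymm (le_of_add_le_add_right h1) zero_le
    · by_contra hne
      have hlt : u s < u t := lt_of_le_of_ne (hlow t ht) (Ne.symm hne)
      have h1 : ∑ t, G.T s a t * (u s).toNNReal < ∑ t, G.T s a t * (u t).toNNReal := by
        refine Finset.sum_lt_sum (fun t _ => hge t) ⟨t, Finset.mem_univ t, ?_⟩
        exact mul_lt_mul_of_pos_left
          ((ENNReal.toNNReal_lt_toNNReal hus (hfin t ht)).2 hlt) (pos_iff_ne_zero.2 ht)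
      rw [hsum] at h1
      exact (h1.trans_le (le_add_self.trans hle)).false

/-! ### Sampled games and their common pre-fixpoints -/

namespace IsSampling

variable {G : SSG S A} {Gs : ℕ → SSG S A}

theorem tendsto_actionValue (hG : G.IsSampling Gs) (v : S → ℝ≥0) (s : S) (a : A) :
    Tendsto (fun n => (Gs n).actionValue v s a) atTop (𝓝 (G.actionValue v s a)) :=
  (hG.R_tendsto s a).add
    (tendsto_finsetSum _ fun t _ => (hG.T_tendsto s a t).mul tendsto_const_nhds)

theorem tendsto_bellman (hG : G.IsSampling Gs) (v : S → ℝ≥0) (s : S) :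
    Tendsto (fun n => (Gs n).bellman v s) atTop (𝓝 (G.bellman v s)) := by
  by_cases h : (G.enabled s).Nonempty
  · have hn : ∀ n, ((Gs n).enabled s).Nonempty := fun n => by rwa [hG.enabled_eq]
    by_cases hs : s ∈ G.Smax
    · have hsn : ∀ n, s ∈ (Gs n).Smax := fun n => by rwa [hG.Smax_eq]
      simp only [G.bellman_of_mem h hs, fun n => (Gs n).bellman_of_mem (hn n) (hsn n),
        hG.enabled_eq]
      exact Tendsto.finset_sup'_nhds_apply h fun a _ => hG.tendsto_actionValue v s a
    · have hsn : ∀ n, s ∉ (Gs n).Smax := fun n => by rwa [hG.Smax_eq]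
      simp only [G.bellman_of_notMem h hs, fun n => (Gs n).bellman_of_notMem (hn n) (hsn n),
        hG.enabled_eq]
      exact Tendsto.finset_inf'_nhds_apply h fun a _ => hG.tendsto_actionValue v s a
  · have hn : ∀ n, ¬ ((Gs n).enabled s).Nonempty := fun n => by rwa [hG.enabled_eq]
    simp only [G.bellman_of_empty h, fun n => (Gs n).bellman_of_empty (hn n)]
    exact tendsto_const_nhds

theorem bddAbove_bellman (hG : G.IsSampling Gs) (n : ℕ) (v : S → ℝ≥0) (s : S) :
    BddAbove (Set.range fun k : {k : ℕ // n ≤ k} => (Gs k.1).bellman v s) :=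
  (hG.tendsto_bellman v s).bddAbove_range.mono
    (Set.range_comp_subset_range (fun k : {k : ℕ // n ≤ k} => k.1)
      (fun k => (Gs k).bellman v s))

/-- The perturbation of `u` by the rank weight bounds the sampled values of every action that
does not increase `u`. -/
theorem eventually_extActionValue_le (hG : G.IsSampling Gs) {u : S → ℝ≥0∞} {s : S} {a : A}
    (hus : u s ≠ ⊤) (hua : G.extActionValue u s a ≤ u s) {c : ℝ≥0} (hc0 : 0 < c) (hc1 : c < 1)
    (hcT : ∀ t, G.T s a t ≠ 0 → c < G.T s a t)
    (hcsum : ∑ t, G.T s a t ≠ 1 → c < 1 - ∑ t, G.T s a t) {ε : ℝ≥0} (hε : 0 < ε) :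
    ∀ᶠ k in atTop, (Gs k).extActionValue (fun t => u t + ε * rankWeight u c t) s a ≤
      u s + ε * rankWeight u c s := by
  obtain ⟨hT, hR, hlev⟩ | hlt := G.level_or_sum_rankWeight_lt hus hua hc0 hc1 hcT hcsum
  -- The perturbed value is constant on the level set, and the sampled action keeps total mass one
  -- and reward zero, so equality holds.
  · filter_upwards [eventually_ge_atTop 1] with k hk
    have h1 : ∀ t, ((Gs k).T s a t : ℝ≥0∞) * (u t + ε * rankWeight u c t) =
        ((Gs k).T s a t : ℝ≥0∞) * (u s + ε * rankWeight u c s) := by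
      intro t
      by_cases ht : G.T s a t = 0
      · simp [hG.T_zero s a t ht k hk]
      · rw [rankWeight_congr c (hlev t ht), hlev t ht]
    rw [extActionValue, hG.R_zero s a hR k hk]
    simp only [h1]
    rw [← Finset.sum_mul, ← ENNReal.ofNNReal_finsetSum, hG.T_one s a hT k hk]
    simp
  · have hfin : ∀ t, G.T s a t ≠ 0 → u t ≠ ⊤ := fun t =>
      G.ne_top_of_extActionValue_le hus hua
    set v : S → ℝ≥0∞ := fun t => u t + ε * rankWeight u c t with hv
    have hvtop : ∀ t, u t ≠ ⊤ → v t ≠ ⊤ := fun t ht => by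
      simp only [hv, ← ENNReal.coe_mul]
      exact ENNReal.add_ne_top.2 ⟨ht, ENNReal.coe_ne_top⟩
    have hvs : ∀ t, u t ≠ ⊤ → (v t).toNNReal = (u t).toNNReal + ε * rankWeight u c t := by
      intro t ht
      simp only [hv, ← ENNReal.coe_mul]
      rw [ENNReal.toNNReal_add ht ENNReal.coe_ne_top, ENNReal.toNNReal_coe]
    have hsum : G.actionValue (fun t => (v t).toNNReal) s a =
        G.actionValue (fun t => (u t).toNNReal) s a + ε * ∑ t, G.T s a t * rankWeight u c t := by
      rw [actionValue, actionValue, add_assoc, Finset.mul_sum, ← Finset.sum_add_distrib]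
      congr 1
      refine Finset.sum_congr rfl fun t _ => ?_
      by_cases ht : G.T s a t = 0
      · simp [ht]
      · rw [hvs t (hfin t ht)]
        ring
    have hu' : G.actionValue (fun t => (u t).toNNReal) s a ≤ (u s).toNNReal := by
      rw [← ENNReal.coe_le_coe, ENNReal.coe_toNNReal hus, ← G.extActionValue_eq_coe hfin]
      exact hua
    -- The strict weight decrease gives strict slack in the limit game, which convergence passes on
    -- to large `k`.
    have hstrict : G.actionValue (fun t => (v t).toNNReal) s a < (v s).toNNReal := by
      rw [hsum, hvs s hus]
      exact add_lt_add_of_le_of_lt hu' (mul_lt_mul_of_pos_left hlt hε)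
    filter_upwards [(hG.tendsto_actionValue (fun t => (v t).toNNReal) s a).eventually
      (gt_mem_nhds hstrict), eventually_ge_atTop 1] with k hk hk1
    rw [(Gs k).extActionValue_eq_coe fun t ht =>
      hvtop t (hfin t fun h0 => ht (hG.T_zero s a t h0 k hk1))]
    refine (ENNReal.coe_le_coe.2 hk.le).trans ?_
    exact (ENNReal.coe_toNNReal (hvtop s hus)).le

/-- Close to a pre-fixpoint of the limit operator there is a common pre-fixpoint of almost all
sampled operators. -/
theorem exists_isPreFixpoint (hG : G.IsSampling Gs) {u : S → ℝ≥0∞}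
    (hu : IsPreFixpoint G.bellman u) {ε : ℝ≥0} (hε : 0 < ε) :
    ∃ v : S → ℝ≥0∞, (∀ s, v s ≤ u s + ε) ∧
      ∃ N, ∀ k, N ≤ k → IsPreFixpoint (Gs k).bellman v := by
  obtain ⟨c, hc0, hc1, hc⟩ := G.exists_lt_transition
  refine ⟨fun t => u t + ε * rankWeight u c t, fun s => ?_, ?_⟩
  · refine add_le_add le_rfl ?_
    exact mul_le_of_le_one_right zero_le (ENNReal.coe_le_one_iff.2 tsub_le_self)
  have hev : ∀ᶠ k in atTop, ∀ s, ∀ a ∈ G.enabled s, u s ≠ ⊤ → G.extActionValue u s a ≤ u s →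
      (Gs k).extActionValue (fun t => u t + ε * rankWeight u c t) s a ≤
        u s + ε * rankWeight u c s := by
    refine eventually_all.2 fun s => (eventually_all_finset _).2 fun a ha => ?_
    refine eventually_imp_distrib_left.2 fun hus => eventually_imp_distrib_left.2 fun hua => ?_
    exact hG.eventually_extActionValue_le hus hua hc0 hc1 (hc s a ha).1 (hc s a ha).2 hε
  obtain ⟨N, hN⟩ := eventually_atTop.1 hev
  refine ⟨N, fun k hk y hy s => ?_⟩
  obtain hus | hus := eq_or_ne (u s) ⊤
  · simp [hus]
  have hval : ∀ a ∈ G.enabled s, G.extActionValue u s a ≤ u s →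
      ((Gs k).actionValue y s a : ℝ≥0∞) ≤ u s + ε * rankWeight u c s := by
    intro a ha hua
    rw [← extActionValue_coe]
    exact ((Gs k).extActionValue_mono hy s a).trans (hN k hk s a ha hus hua)
  by_cases hne : ((Gs k).enabled s).Nonempty
  · by_cases hs : s ∈ (Gs k).Smax
    · rw [(Gs k).bellman_of_mem hne hs]
      obtain ⟨a, ha, hav⟩ := Finset.exists_mem_eq_sup' hne ((Gs k).actionValue y s)
      rw [hav]
      rw [hG.enabled_eq] at ha
      rw [hG.Smax_eq] at hs
      exact hval a ha (G.extActionValue_le_of_mem hu hs ha)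
    · rw [(Gs k).bellman_of_notMem hne hs]
      rw [hG.Smax_eq] at hs
      obtain ⟨a, ha, hua⟩ := G.exists_extActionValue_le hu hs (hG.enabled_eq k ▸ hne)
      have ha' : a ∈ (Gs k).enabled s := by rwa [hG.enabled_eq]
      exact (ENNReal.coe_le_coe.2 (Finset.inf'_le _ ha')).trans (hval a ha hua)
  · simp [(Gs k).bellman_of_empty hne]

/-- A limit is at most every tail supremum, which gives the lower bound; a common pre-fixpoint of a
tail is one of its supremum, which gives the upper bound. -/
theorem tendsto_leastFixpoint_tailSup (hG : G.IsSampling Gs) :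
    Tendsto (fun n => leastFixpoint (tailSup (fun k => (Gs k).bellman) n)) atTop
      (𝓝 (leastFixpoint G.bellman)) := by
  have hlow : ∀ n, leastFixpoint G.bellman ≤
      leastFixpoint (tailSup (fun k => (Gs k).bellman) n) := by
    refine fun n => leastFixpoint_mono fun y s => le_of_tendsto (hG.tendsto_bellman y s) ?_
    filter_upwards [eventually_ge_atTop n] with k hk
    exact le_ciSup (hG.bddAbove_bellman n y s) ⟨k, hk⟩
  refine tendsto_pi_nhds.2 fun s => tendsto_of_le_liminf_of_limsup_le ?_ ?_
  · exact le_liminf_of_le (by isBoundedDefault) (Eventually.of_forall fun n => hlow n s)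
  · refine ENNReal.le_of_forall_pos_le_add fun ε hε _ => ?_
    obtain ⟨v, hv, N, hN⟩ := hG.exists_isPreFixpoint (isPreFixpoint_leastFixpoint G.bellman) hε
    refine limsup_le_of_le (by isBoundedDefault) ?_
    filter_upwards [eventually_ge_atTop N] with n hn
    refine le_trans (IsPreFixpoint.leastFixpoint_le (fun y hy t => ?_) s) (hv s)
    have hne : Nonempty {k : ℕ // n ≤ k} := ⟨⟨n, le_rfl⟩⟩
    rw [tailSup, ENNReal.coe_iSup (hG.bddAbove_bellman n y t)]
    exact iSup_le fun k => hN k.1 (hn.trans k.2) y hy t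

end IsSampling

end SSG

end

theorem mainTheorem4 {S A : Type*} [Fintype S] (G : SSG S A) (Gs : ℕ → SSG S A)
    (hG : G.IsSampling Gs) :
    -- the suprema of the tails are suprema of bounded sets
    (∀ (n : ℕ) (v : S → ℝ≥0) (s : S),
      BddAbove (Set.range fun k : {k : ℕ // n ≤ k} => (Gs k.1).bellman v s)) ∧
    Tendsto (fun n => leastFixpoint (tailSup (fun k => (Gs k).bellman) n)) atTop
      (𝓝 (leastFixpoint G.bellman)) ∧
    -- progressing Mann schemes with scalar parameters
    (∀ α β : ℕ → ℝ, IsProgressingMannScheme α β →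
      ∀ x : ℕ → S → ℝ≥0,
        GeneratedByScheme (fun n _ => α n) (fun n _ => β n) (fun n => (Gs n).bellman) x →
        ConvergesTo x (leastFixpoint G.bellman)) ∧
    -- progressing generalized Mann schemes
    (∀ α β : ℕ → S → ℝ, IsProgressingGeneralizedMannScheme α β →
      ∀ x : ℕ → S → ℝ≥0,
        GeneratedByScheme α β (fun n => (Gs n).bellman) x →
        ConvergesTo x (leastFixpoint G.bellman)) := by
  have hf : ∀ n, IsMonotoneNonexpansive ((Gs n).bellman) := fun n =>
    (Gs n).isMonotoneNonexpansive_bellman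
  refine ⟨hG.bddAbove_bellman, hG.tendsto_leastFixpoint_tailSup, fun α β hsch x hx => ?_,
    fun α β hsch x hx => ?_⟩
  · refine hx.convergesTo (fun _ => hsch.toIsMannScheme) (fun _ => hsch.quotient) hf
      hG.tendsto_bellman fun ε hε => ?_
    -- Half of `ε` is spent on the perturbation `v`, half on the decaying excess over `v`.
    obtain ⟨v, hv, N, hN⟩ :=
      hG.exists_isPreFixpoint (isPreFixpoint_leastFixpoint G.bellman) (half_pos hε)
    filter_upwards [hx.eventually_le_of_scalar hsch.toIsMannScheme hf hN (half_pos hε)]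
      with n hn s
    calc (x n s : ℝ≥0∞) ≤ v s + (ε / 2 : ℝ≥0) := hn s
      _ ≤ leastFixpoint G.bellman s + (ε / 2 : ℝ≥0) + (ε / 2 : ℝ≥0) := by gcongr; exact hv s
      _ = leastFixpoint G.bellman s + ε := by rw [add_assoc, ← ENNReal.coe_add, add_halves]
  · refine hx.convergesTo hsch.scheme hsch.quotient hf hG.tendsto_bellman fun ε hε => ?_
    obtain ⟨v, hv, N, hN⟩ :=
      hG.exists_isPreFixpoint (isPreFixpoint_leastFixpoint G.bellman) (half_pos hε)
    filter_upwards [hx.eventually_le hsch hf hN (half_pos hε)] with n hn s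
    calc (x n s : ℝ≥0∞) ≤ v s + (ε / 2 : ℝ≥0) := hn s
      _ ≤ leastFixpoint G.bellman s + (ε / 2 : ℝ≥0) + (ε / 2 : ℝ≥0) := by gcongr; exact hv s
      _ = leastFixpoint G.bellman s + ε := by rw [add_assoc, ← ENNReal.coe_add, add_halves]
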